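/- Theorem 7.1. Let $\mathbf{MEA}$ (Horsten's modal-epistemic arithmetic) be the following Hilbert-style system. Its language is that of first-order arithmetic with equality, $0$, successor $s$, $+$, $\cdot$ and a function symbol for every primitive recursive function, with the logical symbols $\bot,\wedge,\vee,\supset,\forall,\exists$ and two further unary operators $\Box$ and $P$ on formulas; $\neg A$ abbreviates $A\supset\bot$, and $\Diamond A$ abbreviates $\neg\Box\neg A$. Its axioms and rules are those of Peano arithmetic (classical first-order logic with equality, the axioms for $0$ and $s$, the defining equations of $+$, $\cdot$ and of the primitive recursive function symbols, and induction), with all schemes taken for all formulas of the language, together with - $\Box A\supset A$; $\ \Box A\wedge\Box(A\supset B)\supset\Box B$; from $\vdash A$ infer $\vdash\Box A$; $\ \Diamond A\supset\Box\Diamond A$; $\ \Diamond A\supset A$ if $A$ contains neither $\Box$ nor $P$; $\ \Diamond\exists xA\supset\exists x\Diamond A$; - $PA\supset A$; $\ PA\supset PPA$; - from $\vdash A$ infer $\vdash\Diamond PA$; $\ \Diamond PA\wedge\Diamond P(A\supset B)\supset\Diamond PB$. Let $f$ be any binary primitive recursive function symbol and let $R(x,y)$ be the formula $f(x,y)=0$.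 Then $\mathbf{MEA}$ is closed under each of the following rules: - $(\mathsf{HMR_{Nt}})$ if $\vdash_{\mathbf{MEA}}\Diamond P\,\forall x\,\neg\Diamond P\neg\exists y\,R(x,y)$, then $\vdash_{\mathbf{MEA}}\Diamond P\,\forall x\exists y\,R(x,y)$; - $(\mathsf{HMR_{W1}})$ if $\vdash_{\mathbf{MEA}}\Diamond\forall x\,\Diamond P\,\exists y\,R(x,y)$, then $\vdash_{\mathbf{MEA}}\Diamond P\,\forall x\exists y\,R(x,y)$; - $(\mathsf{HMR_{W2}})$ if $\vdash_{\mathbf{MEA}}\Box\forall x\,\neg\Diamond P\neg\exists y\,R(x,y)$, then $\vdash_{\mathbf{MEA}}\Box\forall x\exists y\,R(x,y)$; - $(\mathsf{HMR_{W3}})$ if $\vdash_{\mathbf{MEA}}\Box\forall x\,\Diamond\exists y\,R(x,y)$, then $\vdash_{\mathbf{MEA}}\Box\forall x\exists y\,R(x,y)$. -/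

import Mathlib

namespace MEA

/-- Function symbols for the primitive recursive functions, indexed by arity: one symbol for each
way of building a primitive recursive function from the constant `0`, successor and the
projections by composition and primitive recursion. -/
inductive PRSym : ℕ → Type
  | zero : PRSym 0
  | succ : PRSym 1
  | proj {n : ℕ} (i : Fin n) : PRSym n
  | comp {m n : ℕ} (f : PRSym m) (g : Fin m → PRSym n) : PRSym n
  | prec {n : ℕ} (f : PRSym n) (g : PRSym (n + 2)) : PRSym (n + 1)

/-- Terms of the language of arithmetic `0, s, +, ·` with a symbol for every primitive recursive
function. Variables are de Bruijn indices. -/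
inductive Term : Type
  | var (i : ℕ) : Term
  | zero : Term
  | succ (t : Term) : Term
  | add (s t : Term) : Term
  | mul (s t : Term) : Term
  | app {n : ℕ} (f : PRSym n) (ts : Fin n → Term) : Term

namespace Term

/-- Simultaneous substitution of `σ i` for the variable `i`. -/
def subst (σ : ℕ → Term) : Term → Term
  | var i => σ i
  | zero => zero
  | succ t => succ (t.subst σ)
  | add s t => add (s.subst σ) (t.subst σ)
  | mul s t => mul (s.subst σ) (t.subst σ)
  | app f ts => app f fun i => (ts i).subst σ

/-- Raise every variable by one. -/
def shift (t : Term) : Term := t.subst fun i => var (i + 1)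

end Term

/-- The substitution `σ` carried under one quantifier. -/
def liftSubst (σ : ℕ → Term) : ℕ → Term
  | 0 => Term.var 0
  | i + 1 => (σ i).shift

/-- The substitution that replaces variable `0` by `t` and lowers the other variables by one. -/
def instSubst (t : Term) : ℕ → Term
  | 0 => t
  | i + 1 => Term.var i

/-- The substitution that replaces variable `0` by its successor and fixes the other variables. -/
def succSubst : ℕ → Term
  | 0 => Term.succ (Term.var 0)
  | i + 1 => Term.var (i + 1)

/-- Formulas of modal-epistemic arithmetic. The quantifiers bind variable `0` of their body;
`box` is the necessity operator and `prov` is the proof operator `P`. -/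
inductive Formula : Type
  | eq (s t : Term) : Formula
  | bot : Formula
  | and (A B : Formula) : Formula
  | or (A B : Formula) : Formula
  | imp (A B : Formula) : Formula
  | all (A : Formula) : Formula
  | ex (A : Formula) : Formula
  | box (A : Formula) : Formula
  | prov (A : Formula) : Formula

namespace Formula

/-- Negation `A ⊃ ⊥`. -/
def neg (A : Formula) : Formula := imp A bot

/-- Possibility `¬ □ ¬ A`. -/
def dia (A : Formula) : Formula := neg (box (neg A))

/-- Capture-avoiding simultaneous substitution of `σ i` for the free variable `i`. -/
def subst : (ℕ → Term) → Formula → Formula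
  | σ, eq s t => eq (s.subst σ) (t.subst σ)
  | _, bot => bot
  | σ, and A B => and (A.subst σ) (B.subst σ)
  | σ, or A B => or (A.subst σ) (B.subst σ)
  | σ, imp A B => imp (A.subst σ) (B.subst σ)
  | σ, all A => all (A.subst (liftSubst σ))
  | σ, ex A => ex (A.subst (liftSubst σ))
  | σ, box A => box (A.subst σ)
  | σ, prov A => prov (A.subst σ)

/-- Raise every free variable by one, so that variable `0` is not free in the result. -/
def shift (A : Formula) : Formula := A.subst fun i => Term.var (i + 1)

/-- The instance `A[t/x]` of the body `A` of a quantifier that binds `x`. -/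
def inst (A : Formula) (t : Term) : Formula := A.subst (instSubst t)

/-- `A` contains neither `□` nor `P`. -/
def Arithmetical : Formula → Prop
  | eq _ _ => True
  | bot => True
  | and A B => A.Arithmetical ∧ B.Arithmetical
  | or A B => A.Arithmetical ∧ B.Arithmetical
  | imp A B => A.Arithmetical ∧ B.Arithmetical
  | all A => A.Arithmetical
  | ex A => A.Arithmetical
  | box _ => False
  | prov _ => False

/-- The formula `R(x, y)`, that is `f(x, y) = 0`, for use in the scope of a quantifier on `x`
(variable `1`) and, directly inside it, a quantifier on `y` (variable `0`). -/
def primRel (f : PRSym 2) : Formula :=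
  eq (Term.app f ![Term.var 1, Term.var 0]) Term.zero

end Formula

open Formula in
/-- Theorems of the Hilbert system of modal-epistemic arithmetic. All schemes are for all formulas
of the language with `□` and `P`. -/
inductive Provable : Formula → Prop
  -- classical propositional logic
  | mp {A B : Formula} : Provable (imp A B) → Provable A → Provable B
  | imp_k (A B : Formula) : Provable (imp A (imp B A))
  | imp_s (A B C : Formula) :
      Provable (imp (imp A (imp B C)) (imp (imp A B) (imp A C)))
  | and_intro (A B : Formula) : Provable (imp A (imp B (and A B)))
  | and_left (A B : Formula) : Provable (imp (and A B) A)
  | and_right (A B : Formula) : Provable (imp (and A B) B)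
  | or_inl (A B : Formula) : Provable (imp A (or A B))
  | or_inr (A B : Formula) : Provable (imp B (or A B))
  | or_elim (A B C : Formula) :
      Provable (imp (imp A C) (imp (imp B C) (imp (or A B) C)))
  | dne (A : Formula) : Provable (imp (neg (neg A)) A)
  -- quantifiers
  | all_elim (A : Formula) (t : Term) : Provable (imp (all A) (A.inst t))
  | ex_intro (A : Formula) (t : Term) : Provable (imp (A.inst t) (ex A))
  | all_rule {A B : Formula} : Provable (imp B.shift A) → Provable (imp B (all A))
  | ex_rule {A B : Formula} : Provable (imp A B.shift) → Provable (imp (ex A) B)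
  -- equality
  | eq_refl (t : Term) : Provable (eq t t)
  | eq_subst (A : Formula) (s t : Term) :
      Provable (imp (eq s t) (imp (A.inst s) (A.inst t)))
  -- successor, addition, multiplication, induction
  | succ_ne_zero (t : Term) : Provable (neg (eq (.succ t) .zero))
  | succ_inj (s t : Term) : Provable (imp (eq (.succ s) (.succ t)) (eq s t))
  | add_zero (s : Term) : Provable (eq (.add s .zero) s)
  | add_succ (s t : Term) : Provable (eq (.add s (.succ t)) (.succ (.add s t)))
  | mul_zero (s : Term) : Provable (eq (.mul s .zero) .zero)
  | mul_succ (s t : Term) : Provable (eq (.mul s (.succ t)) (.add (.mul s t) s))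
  | induction (A : Formula) :
      Provable (imp (and (A.inst .zero) (all (imp A (A.subst succSubst)))) (all A))
  -- defining equations of the primitive recursive function symbols
  | pr_zero (ts : Fin 0 → Term) : Provable (eq (.app .zero ts) .zero)
  | pr_succ (ts : Fin 1 → Term) : Provable (eq (.app .succ ts) (.succ (ts 0)))
  | pr_proj {n : ℕ} (i : Fin n) (ts : Fin n → Term) :
      Provable (eq (.app (.proj i) ts) (ts i))
  | pr_comp {m n : ℕ} (f : PRSym m) (g : Fin m → PRSym n) (ts : Fin n → Term) :
      Provable (eq (.app (.comp f g) ts) (.app f fun i => .app (g i) ts))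
  | pr_prec_zero {n : ℕ} (f : PRSym n) (g : PRSym (n + 2)) (ts : Fin n → Term) :
      Provable (eq (.app (.prec f g) (Matrix.vecCons .zero ts)) (.app f ts))
  | pr_prec_succ {n : ℕ} (f : PRSym n) (g : PRSym (n + 2)) (t : Term) (ts : Fin n → Term) :
      Provable (eq (.app (.prec f g) (Matrix.vecCons (.succ t) ts))
        (.app g (Matrix.vecCons t
          (Matrix.vecCons (.app (.prec f g) (Matrix.vecCons t ts)) ts))))
  -- modal axioms and rule
  | box_elim (A : Formula) : Provable (imp (box A) A)
  | box_mp (A B : Formula) : Provable (imp (and (box A) (box (imp A B))) (box B))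
  | box_nec {A : Formula} : Provable A → Provable (box A)
  | dia_box (A : Formula) : Provable (imp (dia A) (box (dia A)))
  | dia_elim (A : Formula) : A.Arithmetical → Provable (imp (dia A) A)
  | dia_ex (A : Formula) : Provable (imp (dia (ex A)) (ex (dia A)))
  -- epistemic axioms
  | prov_elim (A : Formula) : Provable (imp (prov A) A)
  | prov_prov (A : Formula) : Provable (imp (prov A) (prov (prov A)))
  -- modal-epistemic axiom and rule
  | dia_prov_nec {A : Formula} : Provable A → Provable (dia (prov A))
  | dia_prov_mp (A B : Formula) :
      Provable (imp (and (dia (prov A)) (dia (prov (imp A B)))) (dia (prov B)))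

end MEA

namespace MEA

namespace Formula

/-! The system collapses onto its arithmetical part: deleting every `□` and `P` turns each axiom
into a theorem and each rule into an admissible one (`Provable.erase`), because `◇` becomes a double
negation, which is harmless classically. Since `R` has no modalities, each hypothesis erases to
`∀x∃y R` padded with double negations, and these are removed by `dne`, under the quantifier by
`all_of_all_neg_neg`. The resulting theorem `∀x∃y R` then receives `□` or `◇P` by necessitation. All
that matters about `R` is that erasure fixes it. -/

/-- The formula with every `□` and every `P` deleted. -/
def erase : Formula → Formula
  | eq s t => eq s t
  | bot => bot
  | and A B => and A.erase B.erase
  | or A B => or A.erase B.erase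
  | imp A B => imp A.erase B.erase
  | all A => all A.erase
  | ex A => ex A.erase
  | box A => A.erase
  | prov A => A.erase

/-- Terms carry no modalities, so erasure never meets the substitution. This is what keeps the
quantifier, equality and induction schemes in form under erasure. -/
theorem erase_subst (A : Formula) (σ : ℕ → Term) :
    (A.subst σ).erase = A.erase.subst σ := by
  induction A generalizing σ <;> simp_all [erase, subst]

theorem erase_inst (A : Formula) (t : Term) : (A.inst t).erase = A.erase.inst t :=
  erase_subst A _

theorem erase_shift (A : Formula) : A.shift.erase = A.erase.shift :=
  erase_subst A _

end Formula

namespace Term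

theorem subst_var (t : Term) : t.subst var = t := by
  induction t <;> simp_all [subst]

theorem subst_subst (t : Term) (σ τ : ℕ → Term) :
    (t.subst σ).subst τ = t.subst fun i => (σ i).subst τ := by
  induction t <;> simp_all [subst]

end Term

theorem liftSubst_var : liftSubst Term.var = Term.var := by
  funext i
  cases i <;> rfl

/-- The binder case of composing substitutions, needed for `Formula.subst_subst`. -/
theorem subst_liftSubst (σ τ : ℕ → Term) :
    (fun i => (liftSubst σ i).subst (liftSubst τ)) = liftSubst fun i => (σ i).subst τ := by
  funext i
  cases i with
  | zero => rfl
  | succ i => simp only [liftSubst, Term.shift, Term.subst_subst, Term.subst]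

namespace Formula

theorem subst_var (A : Formula) : A.subst Term.var = A := by
  induction A <;> simp_all [subst, Term.subst_var, liftSubst_var]

theorem subst_subst (A : Formula) (σ τ : ℕ → Term) :
    (A.subst σ).subst τ = A.subst fun i => (σ i).subst τ := by
  induction A generalizing σ τ <;> simp_all [subst, Term.subst_subst, subst_liftSubst]

/-- Weakening the body of a quantifier and instantiating by the new variable changes nothing. -/
theorem inst_subst_liftSubst_var (A : Formula) :
    (A.subst (liftSubst fun i => Term.var (i + 1))).inst (Term.var 0) = A := by
  rw [inst, subst_subst]
  convert subst_var A using 2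
  funext i
  cases i <;> rfl

end Formula

open Formula

namespace Provable

variable {A B C H : Formula}

theorem imp_of (h : Provable B) : Provable (imp A B) :=
  mp (imp_k B A) h

theorem mp_imp (h : Provable (imp H (imp A B))) (h' : Provable (imp H A)) :
    Provable (imp H B) :=
  mp (mp (imp_s H A B) h) h'

theorem imp_trans (h : Provable (imp A B)) (h' : Provable (imp B C)) : Provable (imp A C) :=
  mp_imp (imp_of h') h

theorem imp_refl (A : Formula) : Provable (imp A A) :=
  mp_imp (imp_k A (imp A A)) (imp_k A A)

theorem dni (A : Formula) : Provable (imp A (neg (neg A))) :=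
  imp_trans (imp_k A (neg A)) (mp (imp_s (neg A) A bot) (imp_refl (neg A)))

theorem all_mono (h : Provable (imp A B)) : Provable (imp (all A) (all B)) := by
  refine all_rule (imp_trans ?_ h)
  -- By definition `(all A).shift` is `all` of this body, and its instance at variable `0` is `A`
  -- again.
  have e := all_elim (A.subst (liftSubst fun i => Term.var (i + 1))) (Term.var 0)
  rwa [inst_subst_liftSubst_var] at e

theorem ex_mono (h : Provable (imp A B)) : Provable (imp (ex A) (ex B)) := by
  refine ex_rule (imp_trans h ?_)
  have e := ex_intro (B.subst (liftSubst fun i => Term.var (i + 1))) (Term.var 0)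
  rwa [inst_subst_liftSubst_var] at e

/-- Induction on derivations. The arithmetical and logical schemes are closed under erasure because
they range over all formulas; the modal and epistemic ones become propositional or quantifier
tautologies, and both necessitation rules become trivial up to double negation. -/
theorem erase (h : Provable A) : Provable A.erase := by
  induction h with
  | mp _ _ ih ih' => exact mp ih ih'
  | imp_k A B => exact imp_k _ _
  | imp_s A B C => exact imp_s _ _ _
  | and_intro A B => exact and_intro _ _
  | and_left A B => exact and_left _ _
  | and_right A B => exact and_right _ _
  | or_inl A B => exact or_inl _ _
  | or_inr A B => exact or_inr _ _
  | or_elim A B C => exact or_elim _ _ _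
  | dne A => exact dne _
  | all_elim A t => simpa only [Formula.erase, erase_inst] using all_elim A.erase t
  | ex_intro A t => simpa only [Formula.erase, erase_inst] using ex_intro A.erase t
  | all_rule _ ih => exact all_rule (by simpa only [Formula.erase, erase_shift] using ih)
  | ex_rule _ ih => exact ex_rule (by simpa only [Formula.erase, erase_shift] using ih)
  | eq_refl t => exact eq_refl t
  | eq_subst A s t => simpa only [Formula.erase, erase_inst] using eq_subst A.erase s t
  | succ_ne_zero t => exact succ_ne_zero t
  | succ_inj s t => exact succ_inj s t
  | add_zero s => exact add_zero s
  | add_succ s t => exact add_succ s t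
  | mul_zero s => exact mul_zero s
  | mul_succ s t => exact mul_succ s t
  | induction A =>
    simpa only [Formula.erase, erase_inst, erase_subst] using induction A.erase
  | pr_zero ts => exact pr_zero ts
  | pr_succ ts => exact pr_succ ts
  | pr_proj i ts => exact pr_proj i ts
  | pr_comp f g ts => exact pr_comp f g ts
  | pr_prec_zero f g ts => exact pr_prec_zero f g ts
  | pr_prec_succ f g t ts => exact pr_prec_succ f g t ts
  | box_elim A => exact imp_refl _
  | box_mp A B => exact mp_imp (and_right _ _) (and_left _ _)
  | box_nec _ ih => exact ih
  | dia_box A => exact imp_refl _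
  | dia_elim A _ => exact dne _
  -- The erased axiom is `¬¬∃xA ⊃ ∃x¬¬A`.
  | dia_ex A => exact imp_trans (dne _) (ex_mono (dni _))
  | prov_elim A => exact imp_refl _
  | prov_prov A => exact imp_refl _
  | dia_prov_nec _ ih => exact mp (dni _) ih
  | dia_prov_mp A B =>
    exact imp_trans (mp_imp (imp_trans (and_right _ _) (dne _))
      (imp_trans (and_left _ _) (dne _))) (dni _)

theorem all_of_all_neg_neg (h : Provable (all (neg (neg A)))) : Provable (all A) :=
  mp (all_mono (dne A)) h

end Provable

end MEA

theorem theorem7p1 (f : MEA.PRSym 2) :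
    (MEA.Provable (.dia (.prov (.all (.neg (.dia (.prov (.neg (.ex (.primRel f)))))))))
      → MEA.Provable (.dia (.prov (.all (.ex (.primRel f)))))) ∧
    (MEA.Provable (.dia (.all (.dia (.prov (.ex (.primRel f))))))
      → MEA.Provable (.dia (.prov (.all (.ex (.primRel f)))))) ∧
    (MEA.Provable (.box (.all (.neg (.dia (.prov (.neg (.ex (.primRel f))))))))
      → MEA.Provable (.box (.all (.ex (.primRel f))))) ∧
    (MEA.Provable (.box (.all (.dia (.ex (.primRel f)))))
      → MEA.Provable (.box (.all (.ex (.primRel f))))) := by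
  refine ⟨fun h => ?_, fun h => ?_, fun h => ?_, fun h => ?_⟩
  -- The erased hypothesis is `¬¬∀x¬¬¬¬∃y R`: the inner `◇` contributes two negations, the two
  -- explicit `¬` the others, so two are stripped twice under `∀x`.
  · exact .dia_prov_nec (.all_of_all_neg_neg (.all_of_all_neg_neg (.mp (.dne _) h.erase)))
  · exact .dia_prov_nec (.all_of_all_neg_neg (.mp (.dne _) h.erase))
  · exact .box_nec (.all_of_all_neg_neg (.all_of_all_neg_neg h.erase))
  · exact .box_nec (.all_of_all_neg_neg h.erase)
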